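/- Let $0<t<k<v$ be integers and let $X$ be a $v$-set. A $t$-$(v,k)$ trade on $X$ is a pair $T=\{T_1,T_2\}$ of disjoint collections of $k$-subsets of $X$ (blocks; repetitions allowed) such that every $t$-subset of $X$ is contained in the same number of blocks of $T_1$ and of $T_2$, counted with multiplicity. Its volume is $|T_1|=|T_2|$. The trade is Steiner if every $t$-subset of $X$ is contained in at most one block of $T_1$ and in at most one block of $T_2$. (1) For every $t\ge 3$ and every $i\in\{0,1,\ldots,t-1\}$ there is no Steiner $t$-$(v,t+1)$ trade whose volume $s$ satisfies $$2^{t+1}-2^{t-i}<s<2^{t+1}-2^{t-i-1}.$$ (2) Consequently, the Mahmoodian–Soltankhah conjecture holds for all Steiner trades: for all $0<t<k<v$ and every $i\in\{0,1,\ldots,t-1\}$ there is no Steiner $t$-$(v,k)$ trade whose volume $s$ satisfies $2^{t+1}-2^{t-i}<s<2^{t+1}-2^{t-i-1}$. -/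

import Mathlib

/-- A `t`-`(v,k)` trade on the point set `X`: `0 < t < k < v = |X|`, and `T₁`, `T₂` are two disjoint
collections of blocks (`k`-subsets of `X`; repeated blocks are allowed) such that every `t`-subset
of `X` is contained in the same number of blocks, counted with multiplicity, of `T₁` and `T₂`. -/
structure Trade (X : Type*) [Fintype X] [DecidableEq X] (t v k : ℕ) where
  T₁ : Multiset (Finset X)
  T₂ : Multiset (Finset X)
  pos_t : 0 < t
  t_lt_k : t < k
  k_lt_v : k < v
  card_points : Fintype.card X = v
  card_block₁ : ∀ B ∈ T₁, B.card = k
  card_block₂ : ∀ B ∈ T₂, B.card = k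
  disjoint : Disjoint T₁ T₂
  balanced : ∀ A : Finset X, A.card = t →
    T₁.countP (fun B => A ⊆ B) = T₂.countP (fun B => A ⊆ B)

namespace Trade

/-- The volume of a trade: the number of blocks of `T₁` (which equals that of `T₂`). -/
def vol {X : Type*} [Fintype X] [DecidableEq X] {t v k : ℕ} (T : Trade X t v k) : ℕ :=
  Multiset.card T.T₁

/-- A Steiner trade: every `t`-subset of `X` lies in at most one block of `T₁`
and in at most one block of `T₂`. -/
def IsSteiner {X : Type*} [Fintype X] [DecidableEq X] {t v k : ℕ} (T : Trade X t v k) : Prop :=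
  ∀ A : Finset X, A.card = t →
    T.T₁.countP (fun B => A ⊆ B) ≤ 1 ∧ T.T₂.countP (fun B => A ⊆ B) ≤ 1

end Trade

/-! In a Steiner trade no block repeats, so `T₁ ∪ T₂` is a set `S` of `2 * vol` blocks. Balance
descends to all sets of size at most `t`, so each of these is covered an even number of times: `S`
is a word of a Reed–Muller code of minimum distance `2 ^ (t + 1)`. By Kasami–Tokura
(`EvenCover.exists_card_add_pow`), weights below twice that distance are `2 ^ (t + 2) - 2 ^ j`, and
halving them leaves nothing inside a gap.

The weight theorem is proved by induction through Fourier analysis on the power set. A deficit `e`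
that is not a power of 2 makes every Fourier coefficient nonzero, by splitting `S` in halves, and
makes the signs multiplicative, by splitting it in quarters. Inversion at the point given by these
signs then leaves at most one set in `S`, contradicting parity. -/

open Finset

/-! ### Weights of Reed–Muller words below twice the minimum distance -/

section EvenCover

variable {X : Type*} [DecidableEq X]

/-- A family of sets in which every set with fewer than `n` elements is covered an even number of
times. On a finite ground set, the indicators of such families are the words of a Reed–Muller code
of minimum distance `2 ^ n`. -/
def EvenCover (n : ℕ) (S : Finset (Finset X)) : Prop :=
  ∀ A : Finset X, A.card < n → Even (S.filter (fun B => A ⊆ B)).card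

/-- The parity character `(-1) ^ |L ∩ B|`. -/
def parityChar (L B : Finset X) : ℤ := ∏ x ∈ L, if x ∈ B then -1 else 1

/-- The Fourier coefficient of the indicator of `S` at `L`. -/
def paritySum (S : Finset (Finset X)) (L : Finset X) : ℤ := ∑ B ∈ S, parityChar L B

theorem parityChar_empty (B : Finset X) : parityChar ∅ B = 1 := by simp [parityChar]

theorem parityChar_insert {x : X} {L : Finset X} (hx : x ∉ L) (B : Finset X) :
    parityChar (insert x L) B = parityChar {x} B * parityChar L B := by
  simp only [parityChar, Finset.prod_insert hx, Finset.prod_singleton]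

theorem parityChar_eq_or (L B : Finset X) : parityChar L B = 1 ∨ parityChar L B = -1 := by
  induction L using Finset.induction_on with
  | empty => simp [parityChar_empty]
  | insert x L hx ih =>
    rw [parityChar_insert hx]
    by_cases h : x ∈ B <;> rcases ih with ih | ih <;> simp [parityChar, h] at ih ⊢ <;> simp [ih]

theorem paritySum_empty (S : Finset (Finset X)) : paritySum S ∅ = S.card := by
  simp [paritySum, parityChar_empty]

/-- Over `ZMod 2` a half-space is an affine polynomial, so multiplying by its indicator raises the
degree of a monomial by at most one. -/
theorem indicator_parityChar_zmod (L B : Finset X) {s : ℤ} (hs : s = 1 ∨ s = -1) :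
    (if parityChar L B = s then (1 : ZMod 2) else 0) =
      (if s = 1 then 1 else 0) + ∑ x ∈ L, if x ∈ B then 1 else 0 := by
  have h2 : (1 : ZMod 2) + 1 = 0 := rfl
  induction L using Finset.induction_on with
  | empty => rcases hs with rfl | rfl <;> simp [parityChar_empty]
  | insert x L hx ih =>
    rw [parityChar_insert hx, Finset.sum_insert hx, add_left_comm, ← ih]
    by_cases h : x ∈ B
    · rcases parityChar_eq_or L B with hL | hL <;> rcases hs with rfl | rfl <;>
        simp [parityChar] at hL ⊢ <;> simp [h, hL, h2]
    · simp [parityChar, h]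

/-- Splitting an evenly covered family by a parity character costs one degree of evenness. -/
theorem EvenCover.filter_parityChar {n : ℕ} {S : Finset (Finset X)} (hS : EvenCover (n + 1) S)
    (L : Finset X) {s : ℤ} (hs : s = 1 ∨ s = -1) :
    EvenCover n (S.filter (fun B => parityChar L B = s)) := by
  intro A hA
  have cast_card : ∀ A : Finset X, A.card < n + 1 →
      ∑ B ∈ S, (if A ⊆ B then (1 : ZMod 2) else 0) = 0 := by
    intro A hA
    rw [← Finset.natCast_card_filter]
    exact (ZMod.natCast_eq_zero_iff_even).2 (hS A hA)
  rw [← ZMod.natCast_eq_zero_iff_even, Finset.filter_filter, Finset.natCast_card_filter]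
  have key : ∀ B ∈ S, (if parityChar L B = s ∧ A ⊆ B then (1 : ZMod 2) else 0) =
      (if s = 1 then 1 else 0) * (if A ⊆ B then 1 else 0) +
        ∑ x ∈ L, if insert x A ⊆ B then 1 else 0 := by
    intro B _
    by_cases hAB : A ⊆ B
    · simpa [hAB, Finset.insert_subset_iff] using indicator_parityChar_zmod L B hs
    · simp [hAB, Finset.insert_subset_iff]
  rw [Finset.sum_congr rfl key, Finset.sum_add_distrib, ← Finset.mul_sum,
    cast_card A (by omega), Finset.sum_comm]
  rw [Finset.sum_eq_zero (fun x _ => cast_card (insert x A)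
    (by have := Finset.card_insert_le x A; omega))]
  simp

theorem two_mul_indicator {c s : ℤ} (hc : c = 1 ∨ c = -1) (hs : s = 1 ∨ s = -1) :
    2 * (if c = s then (1 : ℤ) else 0) = 1 + s * c := by
  rcases hc with rfl | rfl <;> rcases hs with rfl | rfl <;> norm_num

theorem two_mul_card_filter_parityChar (S : Finset (Finset X)) (L : Finset X) {s : ℤ}
    (hs : s = 1 ∨ s = -1) :
    2 * ((S.filter (fun B => parityChar L B = s)).card : ℤ) = S.card + s * paritySum S L := by
  rw [Finset.natCast_card_filter, Finset.mul_sum,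
    Finset.sum_congr rfl (fun B _ => two_mul_indicator (parityChar_eq_or L B) hs),
    Finset.sum_add_distrib, ← Finset.mul_sum]
  simp [paritySum]

theorem four_mul_card_filter_parityChar (S : Finset (Finset X)) {x : X} {L : Finset X}
    (hx : x ∉ L) {s r : ℤ} (hs : s = 1 ∨ s = -1) (hr : r = 1 ∨ r = -1) :
    4 * (((S.filter (fun B => parityChar {x} B = s)).filter
        (fun B => parityChar L B = r)).card : ℤ) =
      S.card + s * paritySum S {x} + r * paritySum S L +
        s * r * paritySum S (insert x L) := by
  have key : ∀ B ∈ S, 4 * (if parityChar {x} B = s ∧ parityChar L B = r then (1 : ℤ) else 0) =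
      1 + s * parityChar {x} B + r * parityChar L B + s * r * parityChar (insert x L) B := by
    intro B _
    rw [parityChar_insert hx, ite_and]
    have h1 := two_mul_indicator (parityChar_eq_or {x} B) hs
    have h2 := two_mul_indicator (parityChar_eq_or L B) hr
    split_ifs at * <;> nlinarith [congrArg₂ (· * ·) h1 h2]
  rw [Finset.filter_filter, Finset.natCast_card_filter, Finset.mul_sum,
    Finset.sum_congr rfl key]
  simp [Finset.sum_add_distrib, ← Finset.mul_sum, paritySum]

theorem sum_parityChar_mul_le [Fintype X] (B C : Finset X) :
    ∑ L : Finset X, parityChar L B * parityChar L C ≤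
      if B = C then 2 ^ Fintype.card X else 0 := by
  have h : ∑ L : Finset X, parityChar L B * parityChar L C =
      ∏ x : X, (1 + (if x ∈ B then (-1 : ℤ) else 1) * (if x ∈ C then -1 else 1)) := by
    rw [Finset.prod_one_add, Finset.powerset_univ]
    simp only [parityChar, Finset.prod_mul_distrib]
  rw [h]
  split_ifs with hBC
  · subst hBC
    refine le_of_eq ?_
    rw [Finset.prod_congr rfl (g := fun _ => (2 : ℤ))
      (fun x _ => by by_cases hx : x ∈ B <;> simp [hx])]
    simp
  · obtain ⟨x, hx⟩ : ∃ x, ¬ (x ∈ B ↔ x ∈ C) := by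
      by_contra! hcon
      exact hBC (Finset.ext hcon)
    refine le_of_eq (Finset.prod_eq_zero (Finset.mem_univ x) ?_)
    by_cases h1 : x ∈ B <;> by_cases h2 : x ∈ C <;> simp_all

theorem sum_paritySum_mul_le [Fintype X] (S : Finset (Finset X)) (C : Finset X) :
    ∑ L : Finset X, paritySum S L * parityChar L C ≤ 2 ^ Fintype.card X := by
  simp only [paritySum, Finset.sum_mul]
  rw [Finset.sum_comm]
  refine (Finset.sum_le_sum fun B _ => sum_parityChar_mul_le B C).trans ?_
  rw [Finset.sum_ite_eq']
  split_ifs <;> simp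

/-- A family cannot have Fourier coefficients that are all nonzero and whose signs multiply like
those of a character, unless it has at most one member. -/
theorem card_le_one_of_paritySum_mul_pos [Fintype X] {S : Finset (Finset X)}
    (hS : 0 < S.card)
    (h : ∀ (x : X) (L : Finset X), x ∉ L →
      0 < paritySum S {x} * paritySum S L * paritySum S (insert x L)) :
    S.card ≤ 1 := by
  -- The only candidate for a character with the signs of the coefficients: it is determined by the
  -- singletons.
  set C : Finset X := univ.filter (fun x => paritySum S {x} < 0) with hC
  have hpos : ∀ L : Finset X, 0 < paritySum S L * parityChar L C := by
    intro L
    induction L using Finset.induction_on with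
    | empty => simpa [paritySum_empty, parityChar_empty] using hS
    | insert x L hx ih =>
      have hxL := h x L hx
      rw [parityChar_insert hx]
      by_cases hneg : paritySum S {x} < 0
      · have hx1 : parityChar {x} C = -1 := by simp [parityChar, hC, hneg]
        rw [hx1]
        rcases parityChar_eq_or L C with hL | hL <;> rw [hL] at ih ⊢ <;>
          by_contra! hcon <;> nlinarith [mul_nonneg ih.le (neg_nonneg.2 hneg.le),
            mul_nonneg (mul_nonneg ih.le (neg_nonneg.2 hneg.le)) (neg_nonneg.2 hcon)]
      · have hx1 : parityChar {x} C = 1 := by simp [parityChar, hC, hneg]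
        rw [hx1]
        push Not at hneg
        rcases parityChar_eq_or L C with hL | hL <;> rw [hL] at ih ⊢ <;>
          by_contra! hcon <;> nlinarith [mul_nonneg ih.le hneg,
            mul_nonneg (mul_nonneg ih.le hneg) (neg_nonneg.2 hcon)]
  have hsum := sum_paritySum_mul_le S C
  -- Positive integers are at least 1, so the terms `L ≠ ∅` already use up all but 1 of the bound `2
  -- ^ |X|`; the term `L = ∅` is `S.card`.
  have hrest : ∑ L ∈ univ.erase (∅ : Finset X), (1 : ℤ) ≤
      ∑ L ∈ univ.erase (∅ : Finset X), paritySum S L * parityChar L C :=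
    Finset.sum_le_sum fun L _ => hpos L
  have hsplit := Finset.add_sum_erase univ
    (fun L : Finset X => paritySum S L * parityChar L C) (Finset.mem_univ ∅)
  simp only [paritySum_empty, parityChar_empty, mul_one] at hsplit
  have hone := Finset.add_sum_erase univ (fun _ : Finset X => (1 : ℤ)) (Finset.mem_univ ∅)
  simp only [Finset.sum_const, Finset.card_univ, Fintype.card_finset, nsmul_eq_mul, mul_one,
    Nat.cast_pow, Nat.cast_ofNat] at hone hrest
  have : (S.card : ℤ) ≤ 1 := by linarith
  exact_mod_cast this

theorem exists_sign_mul_eq_neg_abs (z : ℤ) :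
    ∃ s : ℤ, (s = 1 ∨ s = -1) ∧ s * z = -|z| := by
  rcases le_total 0 z with hz | hz
  · exact ⟨-1, Or.inr rfl, by rw [abs_of_nonneg hz]; ring⟩
  · exact ⟨1, Or.inl rfl, by rw [abs_of_nonpos hz]; ring⟩

/-- For `j ≤ a` the left side is too large. Otherwise `2 ^ a` divides `e`, which lies strictly
between consecutive multiples of it. -/
theorem sum_three_pow_ne {a b₁ b₂ b₃ j : ℕ} {e : ℤ} (h₁ : a + 1 ≤ b₁) (h₂ : a + 1 ≤ b₂)
    (h₃ : a + 1 ≤ b₃) (hlo : 2 ^ a < e) (hhi : e < 2 ^ (a + 1)) :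
    (2 : ℤ) ^ b₁ + 2 ^ b₂ + 2 ^ b₃ ≠ 2 * e + 2 ^ j := by
  intro h
  have hdvd : ∀ {b : ℕ}, a + 1 ≤ b → (2 : ℤ) ^ (a + 1) ∣ 2 ^ b := fun hb => pow_dvd_pow 2 hb
  rcases le_or_gt j a with hj | hj
  · have hle : ∀ {b : ℕ}, a + 1 ≤ b → (2 : ℤ) ^ (a + 1) ≤ 2 ^ b :=
      fun hb => pow_le_pow_right₀ (by norm_num) hb
    have := hle h₁
    have := hle h₂
    have := hle h₃
    have : (2 : ℤ) ^ j ≤ 2 ^ a := pow_le_pow_right₀ (by norm_num) hj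
    have : (0 : ℤ) < 2 ^ a := by positivity
    rw [pow_succ] at *
    linarith
  · have hsum : (2 : ℤ) ^ (a + 1) ∣ 2 * e := by
      have : 2 * e = 2 ^ b₁ + 2 ^ b₂ + 2 ^ b₃ - 2 ^ j := by linarith
      rw [this]
      exact dvd_sub (dvd_add (dvd_add (hdvd h₁) (hdvd h₂)) (hdvd h₃)) (hdvd hj)
    obtain ⟨c, hc⟩ := hsum
    have hpos : (0 : ℤ) < 2 ^ a := by positivity
    rw [pow_succ] at hc hhi
    have he : e = 2 ^ a * c := by linarith
    have h1 : 1 < c := by by_contra! hcon; nlinarith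
    have h2 : c < 2 := by by_contra! hcon; nlinarith
    omega

/-- The weights below twice the minimum distance (Kasami–Tokura): an evenly covered family of
fewer than `2 ^ (n + 1)` sets has `2 ^ (n + 1) - 2 ^ j` members for some `j`. -/
theorem EvenCover.exists_card_add_pow [Fintype X] :
    ∀ (n : ℕ) {S : Finset (Finset X)}, EvenCover n S → S.card < 2 ^ (n + 1) →
      ∃ j : ℕ, S.card + 2 ^ j = 2 ^ (n + 1)
  | 0, S, _, hlt => by
    have : S.card = 0 ∨ S.card = 1 := by omega
    rcases this with h | h
    · exact ⟨1, by simp [h]⟩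
    · exact ⟨0, by simp [h]⟩
  | 1, S, hS, hlt => by
    have h := hS ∅ (by simp)
    simp only [Finset.empty_subset, Finset.filter_true] at h
    obtain ⟨c, hc⟩ := h
    have : c = 0 ∨ c = 1 := by omega
    rcases this with h | h
    · exact ⟨2, by simp [hc, h]⟩
    · exact ⟨1, by simp [hc, h]⟩
  | n + 2, S, hS, hlt => by
    by_contra! hcon
    obtain ⟨e, he⟩ : ∃ e, S.card + e = 2 ^ (n + 2 + 1) := ⟨_, Nat.add_sub_cancel' hlt.le⟩
    have hepos : e ≠ 0 := by
      rintro rfl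
      exact hlt.ne he
    set a := Nat.log 2 e with ha
    have hlo : 2 ^ a < e := by
      refine lt_of_le_of_ne (Nat.pow_log_le_self 2 hepos) fun h => hcon a ?_
      rw [h, he]
    have hhi : e < 2 ^ (a + 1) := Nat.lt_pow_succ_log_self (by norm_num) e
    have heZ : (S.card : ℤ) + e = 2 ^ (n + 2 + 1) := by exact_mod_cast he
    have hloZ : (2 : ℤ) ^ a < e := by exact_mod_cast hlo
    have hhiZ : (e : ℤ) < 2 ^ (a + 1) := by exact_mod_cast hhi
    -- The sign `s` picks the smaller half, of size `(S.card - |paritySum S L|) / 2`, to which the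
    -- induction hypothesis applies.
    have hhalf : ∀ L : Finset X, ∃ b : ℕ, a + 1 ≤ b ∧ |paritySum S L| = 2 ^ b - e := by
      intro L
      obtain ⟨s, hs, hsz⟩ := exists_sign_mul_eq_neg_abs (paritySum S L)
      have hcard := two_mul_card_filter_parityChar S L hs
      rw [hsz] at hcard
      have habs := abs_nonneg (paritySum S L)
      have hsmall : (S.filter (fun B => parityChar L B = s)).card < 2 ^ (n + 1 + 1) := by
        have hltZ : (S.card : ℤ) < 2 ^ (n + 2 + 1) := by exact_mod_cast hlt
        have : ((S.filter (fun B => parityChar L B = s)).card : ℤ) < 2 ^ (n + 1 + 1) := by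
          rw [pow_succ] at hltZ
          linarith
        exact_mod_cast this
      obtain ⟨j, hj⟩ := exists_card_add_pow (n + 1) (hS.filter_parityChar L hs) hsmall
      have hjZ : ((S.filter (fun B => parityChar L B = s)).card : ℤ) + 2 ^ j =
          2 ^ (n + 1 + 1) := by exact_mod_cast hj
      have hval : |paritySum S L| = 2 ^ (j + 1) - e := by
        rw [pow_succ] at heZ ⊢
        linarith
      refine ⟨j + 1, ?_, hval⟩
      have : (2 : ℤ) ^ a < 2 ^ (j + 1) := by linarith
      exact (pow_lt_pow_iff_right₀ (by norm_num)).1 this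
    have hne : ∀ L : Finset X, paritySum S L ≠ 0 := by
      intro L h0
      obtain ⟨b, hb, hval⟩ := hhalf L
      rw [h0, abs_zero] at hval
      have : (2 : ℤ) ^ (a + 1) ≤ 2 ^ b := pow_le_pow_right₀ (by norm_num) hb
      linarith
    have hpos : 0 < S.card := by
      have := hne ∅
      rw [paritySum_empty] at this
      exact Nat.pos_of_ne_zero (by exact_mod_cast this)
    have hle := card_le_one_of_paritySum_mul_pos hpos fun x L hx => by
      -- If the product is not positive, signs `s`, `r` exist that make all three terms of the
      -- quarter's size negative; the case `n` for this quarter gives the forbidden equation of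
      -- `sum_three_pow_ne`.
      by_contra! hprod
      obtain ⟨s, hs, hsz⟩ := exists_sign_mul_eq_neg_abs (paritySum S {x})
      obtain ⟨r, hr, hrz⟩ := exists_sign_mul_eq_neg_abs (paritySum S L)
      have hcard := four_mul_card_filter_parityChar S hx hs hr
      have hsr : s * r * paritySum S (insert x L) = -|paritySum S (insert x L)| := by
        have hxpos := abs_pos.2 (hne {x})
        have hLpos := abs_pos.2 (hne L)
        have hmul : |paritySum S {x}| * |paritySum S L| *
            (s * r * paritySum S (insert x L)) ≤ 0 := by
          have hs2 : s * s = 1 := by rcases hs with rfl | rfl <;> norm_num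
          have hr2 : r * r = 1 := by rcases hr with rfl | rfl <;> norm_num
          calc _ = (-|paritySum S {x}|) * (-|paritySum S L|) *
                (s * r * paritySum S (insert x L)) := by ring
            _ = (s * s) * (r * r) *
                (paritySum S {x} * paritySum S L * paritySum S (insert x L)) := by
                rw [← hsz, ← hrz]; ring
            _ ≤ 0 := by rw [hs2, hr2]; linarith
        have hle : s * r * paritySum S (insert x L) ≤ 0 := by
          by_contra! hc
          have := mul_pos (mul_pos hxpos hLpos) hc
          linarith
        have habs : |s * r * paritySum S (insert x L)| = |paritySum S (insert x L)| := by
          rcases hs with rfl | rfl <;> rcases hr with rfl | rfl <;> simp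
        rw [← habs, abs_of_nonpos hle, neg_neg]
      rw [hsz, hrz, hsr] at hcard
      obtain ⟨b₁, hb₁, hv₁⟩ := hhalf {x}
      obtain ⟨b₂, hb₂, hv₂⟩ := hhalf L
      obtain ⟨b₃, hb₃, hv₃⟩ := hhalf (insert x L)
      set Q := (S.filter (fun B => parityChar {x} B = s)).filter
        (fun B => parityChar L B = r) with hQ
      have hpow : (2 : ℤ) ^ (n + 3) = 4 * 2 ^ (n + 1) := by ring
      have hsmall : Q.card < 2 ^ (n + 1) := by
        have : (Q.card : ℤ) < 2 ^ (n + 1) := by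
          have h1 := abs_nonneg (paritySum S {x})
          have h2 := abs_nonneg (paritySum S L)
          have h3 := abs_nonneg (paritySum S (insert x L))
          have h4 : (0 : ℤ) < 2 ^ a := by positivity
          linarith
        exact_mod_cast this
      obtain ⟨j, hj⟩ := exists_card_add_pow n
        ((hS.filter_parityChar {x} hs).filter_parityChar L hr) hsmall
      have hjZ : (Q.card : ℤ) + 2 ^ j = 2 ^ (n + 1) := by exact_mod_cast hj
      refine sum_three_pow_ne (j := j + 2) hb₁ hb₂ hb₃ hloZ hhiZ ?_
      have : (2 : ℤ) ^ (j + 2) = 4 * 2 ^ j := by ring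
      linarith
    have heven := hS ∅ (by simp)
    simp only [Finset.empty_subset, Finset.filter_true] at heven
    obtain ⟨c, hc⟩ := heven
    omega

end EvenCover

/-! ### From trades to evenly covered families -/

section SteinerTrades

variable {X : Type*} [DecidableEq X]

/-- A `t`-subset of a repeated block would be covered twice. -/
theorem Multiset.nodup_of_countP_le_one {t k : ℕ} {M : Multiset (Finset X)} (htk : t < k)
    (hM : ∀ B ∈ M, B.card = k)
    (h : ∀ A : Finset X, A.card = t → M.countP (fun B => A ⊆ B) ≤ 1) : M.Nodup := by
  rw [Multiset.nodup_iff_count_le_one]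
  intro B
  by_cases hB : B ∈ M
  · obtain ⟨A, hAB, hA⟩ := Finset.exists_subset_card_eq (htk.le.trans (hM B hB).ge)
    refine le_trans ?_ (h A hA)
    rw [Multiset.count, Multiset.countP_eq_card_filter, Multiset.countP_eq_card_filter]
    refine Multiset.card_le_card (Multiset.monotone_filter_right M ?_)
    rintro B' rfl
    exact hAB
  · simp [Multiset.count_eq_zero_of_notMem hB]

variable [Fintype X]

/-- Double counting of chains `A ⊆ A' ⊆ B`. The binomial factor is positive when `t ≤ k` and can be
cancelled, so balance at size `t` descends to smaller sets. -/
theorem Multiset.sum_powersetCard_countP_superset {t k : ℕ} (M : Multiset (Finset X))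
    (hM : ∀ B ∈ M, B.card = k) {A : Finset X} (hA : A.card ≤ t) :
    ∑ A' ∈ (univ.powersetCard t).filter (fun A' => A ⊆ A'), M.countP (fun B => A' ⊆ B) =
      (k - A.card).choose (t - A.card) * M.countP (fun B => A ⊆ B) := by
  induction M using Multiset.induction_on with
  | empty => simp
  | cons B M ih =>
    simp only [Multiset.countP_cons, Finset.sum_add_distrib, mul_add]
    rw [ih fun B' hB' => hM B' (Multiset.mem_cons_of_mem hB')]
    congr 1
    rw [← Finset.card_filter, Finset.filter_filter]
    have hB := hM B (Multiset.mem_cons_self B M)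
    split_ifs with hAB
    · rw [mul_one, ← hB, ← Finset.card_sdiff_of_subset hAB, ← Finset.card_powersetCard]
      refine Finset.card_bij' (fun A' _ => A' \ A) (fun D _ => D ∪ A) ?_ ?_ ?_ ?_
      · intro A' hA'
        simp only [Finset.mem_filter, Finset.mem_powersetCard_univ] at hA'
        rw [Finset.mem_powersetCard]
        exact ⟨Finset.sdiff_subset_sdiff hA'.2.2 le_rfl,
          by rw [Finset.card_sdiff_of_subset hA'.2.1, hA'.1]⟩
      · intro D hD
        rw [Finset.mem_powersetCard] at hD
        simp only [Finset.mem_filter, Finset.mem_powersetCard_univ]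
        refine ⟨?_, Finset.subset_union_right,
          Finset.union_subset (hD.1.trans Finset.sdiff_subset) hAB⟩
        rw [Finset.card_union_of_disjoint
          (Finset.disjoint_of_subset_left hD.1 Finset.sdiff_disjoint), hD.2]
        omega
      · intro A' hA'
        simp only [Finset.mem_filter] at hA'
        exact Finset.sdiff_union_of_subset hA'.2.1
      · intro D hD
        rw [Finset.mem_powersetCard] at hD
        exact Finset.union_sdiff_cancel_right
          (Finset.disjoint_of_subset_left hD.1 Finset.sdiff_disjoint)
    · rw [mul_zero, Finset.card_eq_zero, Finset.filter_eq_empty_iff]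
      rintro A' _ ⟨h1, h2⟩
      exact hAB (h1.trans h2)

namespace Trade

variable {t v k : ℕ}

theorem balanced_of_card_le (T : Trade X t v k) {A : Finset X} (hA : A.card ≤ t) :
    T.T₁.countP (fun B => A ⊆ B) = T.T₂.countP (fun B => A ⊆ B) := by
  have hpos : 0 < (k - A.card).choose (t - A.card) :=
    Nat.choose_pos (Nat.sub_le_sub_right T.t_lt_k.le _)
  refine Nat.eq_of_mul_eq_mul_left hpos ?_
  rw [← Multiset.sum_powersetCard_countP_superset _ T.card_block₁ hA,
    ← Multiset.sum_powersetCard_countP_superset _ T.card_block₂ hA]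
  refine Finset.sum_congr rfl fun A' hA' => T.balanced A' ?_
  simpa using (Finset.mem_filter.1 hA').1

theorem card_eq_card (T : Trade X t v k) : Multiset.card T.T₁ = Multiset.card T.T₂ := by
  simpa using T.balanced_of_card_le (A := ∅) (by simp)

/-- The Mahmoodian–Soltankhah conjecture for trades without repeated blocks: a volume below
`2 ^ (t + 1)` has the form `2 ^ (t + 1) - 2 ^ j`. -/
theorem exists_vol_add_pow (T : Trade X t v k) (h₁ : T.T₁.Nodup) (h₂ : T.T₂.Nodup)
    (hvol : T.vol < 2 ^ (t + 1)) : ∃ j : ℕ, T.vol + 2 ^ j = 2 ^ (t + 1) := by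
  let S : Finset (Finset X) := ⟨T.T₁ + T.T₂, Multiset.nodup_add.2 ⟨h₁, h₂, T.disjoint⟩⟩
  have hfilter : ∀ A : Finset X, (S.filter (fun B => A ⊆ B)).card =
      T.T₁.countP (fun B => A ⊆ B) + T.T₂.countP (fun B => A ⊆ B) := by
    intro A
    rw [← Multiset.countP_add, Multiset.countP_eq_card_filter]
    rfl
  have hcard : S.card = 2 * T.vol := by
    have : S.card = Multiset.card T.T₁ + Multiset.card T.T₂ := Multiset.card_add _ _
    rw [this, ← T.card_eq_card, vol, two_mul]
  have hS : EvenCover (t + 1) S := by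
    intro A hA
    rw [hfilter, T.balanced_of_card_le (by omega)]
    exact ⟨_, rfl⟩
  obtain ⟨j, hj⟩ := hS.exists_card_add_pow (t + 1) (by rw [hcard, pow_succ]; omega)
  rw [hcard, pow_succ 2 (t + 1)] at hj
  -- The value `j = 0` is excluded by parity, so the equation can be halved.
  rcases j with _ | j
  · omega
  · exact ⟨j, by rw [pow_succ] at hj; omega⟩

theorem IsSteiner.not_vol_in_gap {T : Trade X t v k} (hT : T.IsSteiner) {i : ℕ}
    (hlo : 2 ^ (t + 1) - 2 ^ (t - i) < T.vol) (hhi : T.vol < 2 ^ (t + 1) - 2 ^ (t - i - 1)) :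
    i ≥ t := by
  by_contra! hi
  obtain ⟨j, hj⟩ := T.exists_vol_add_pow
    (Multiset.nodup_of_countP_le_one T.t_lt_k T.card_block₁ fun A hA => (hT A hA).1)
    (Multiset.nodup_of_countP_le_one T.t_lt_k T.card_block₂ fun A hA => (hT A hA).2)
    (hhi.trans_le (Nat.sub_le _ _))
  -- The two bounds place `j` strictly between the consecutive integers `t - i - 1` and `t - i`.
  have h1 : 2 ^ j < 2 ^ (t - i) := by omega
  have h2 : 2 ^ (t - i - 1) < 2 ^ j := by omega
  have h1' := (Nat.pow_lt_pow_iff_right (by norm_num)).1 h1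
  have h2' := (Nat.pow_lt_pow_iff_right (by norm_num)).1 h2
  omega

end Trade

end SteinerTrades

theorem theorem3p1 {X : Type*} [Fintype X] [DecidableEq X] :
    (∀ t v i : ℕ, 3 ≤ t → i < t →
      ¬ ∃ T : Trade X t v (t + 1), T.IsSteiner ∧
        2 ^ (t + 1) - 2 ^ (t - i) < T.vol ∧ T.vol < 2 ^ (t + 1) - 2 ^ (t - i - 1)) ∧
    (∀ t v k i : ℕ, i < t →
      ¬ ∃ T : Trade X t v k, T.IsSteiner ∧
        2 ^ (t + 1) - 2 ^ (t - i) < T.vol ∧ T.vol < 2 ^ (t + 1) - 2 ^ (t - i - 1)) := by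
  refine ⟨?_, ?_⟩
  · rintro t v i - hi ⟨T, hT, hlo, hhi⟩
    exact absurd (hT.not_vol_in_gap hlo hhi) (not_le.2 hi)
  · rintro t v k i hi ⟨T, hT, hlo, hhi⟩
    exact absurd (hT.not_vol_in_gap hlo hhi) (not_le.2 hi)
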